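/- Let $G$ be an undirected graph with $N$ nodes, to which a self-loop is added at every node; let $A$ be the resulting $0/1$ adjacency matrix (with ones on the diagonal), $D$ the diagonal matrix of its row sums, and $P = D^{-1/2} A D^{-1/2}$. Let $L \ge 1$, let $d_0,\dots,d_{L+1}$ be widths, $X \in \mathbb{R}^{N\times d_0}$ the features and $Y \in \mathbb{R}^{N \times d_{L+1}}$ the targets. For weights $\theta = (W^{(\ell)})_{\ell=1}^{L+1}$ with $W^{(\ell)} \in \mathbb{R}^{d_{\ell-1}\times d_\ell}$, consider the $L$-layer ReLU graph convolutional network and its square loss $$H^{(0)} = X,\qquad H^{(\ell)} = \mathrm{ReLU}\big(P H^{(\ell-1)} W^{(\ell)}\big)\ (1 \le \ell \le L),\qquad \mathcal{L}(\theta) = \tfrac12 \big\| H^{(L)} W^{(L+1)} - Y \big\|_F^2 .$$ Starting from $\theta_0$, run full-batch gradient descent $\theta_{t+1} = \theta_t - \eta \nabla \mathcal{L}(\theta_t)$ with learning rate $\eta>0$ on all the weight matrices, the gradient being computed by the chain rule (back-propagation) with the convention $\mathrm{ReLU}'(0)=0$. Assume $d_L \ge N$. Let $s \ge \|P\|_2$,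 let $C_1,\dots,C_{L+1}$ be any positive numbers, and put $\lambda_\ell = \|W^{(\ell)}_0\|_2 + C_\ell$ (spectral norm) and $\lambda_{i\to j} = \prod_{\ell=i}^{j}\lambda_\ell$. Let $\alpha_0$ be the smallest singular value of $H^{(L)}_0$ (the representation $H^{(L)}$ at $\theta_0$), and assume $\alpha_0 > 0$ and $$\alpha_0^2 \ \ge\ 16\, s^{2L} \|X\|_F \max_{1\le \ell\le L+1} \frac{\lambda_{1\to L+1}}{\lambda_\ell C_\ell}\, \sqrt{2\mathcal{L}(\theta_0)},$$ $$\alpha_0^3 \ \ge\ 32\, s^{2L} \|X\|_F^2\, \lambda_{L+1} \sum_{\ell=1}^{L} \frac{\lambda_{1\to L}^2}{\lambda_\ell^2}\, \sqrt{2\mathcal{L}(\theta_0)},$$ $$\alpha_0^2 \ \ge\ 16\, s^{2L} \|X\|_F^2\, \lambda_{L+1}^2 \sum_{\ell=1}^{L} \frac{\lambda_{1\to L}^2}{\lambda_\ell^2}.$$ Let the learning rate satisfy $$0 < \eta \ \le\ \min\left( \frac{8}{\alpha_0^2},\ \frac{\sum_{\ell=1}^{L} \lambda_\ell^{-2}}{s^{2L}\,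 \lambda_{1\to L+1}^2\, \|X\|_F^2\, \big(\sum_{\ell=1}^{L+1}\lambda_\ell^{-2}\big)^2} \right).$$ Then for every $\varepsilon > 0$ and every integer $T \ge 0$ with $$T \ \ge\ \frac{8}{\eta\,\alpha_0^2}\, \log\left(\frac{\mathcal{L}(\theta_0)}{\varepsilon}\right)$$ one has $\mathcal{L}(\theta_T) \le \varepsilon$. (If $\mathcal{L}(\theta_0) = 0$, this holds for every $T \ge 0$.) -/

import Mathlib

namespace GCN

noncomputable section

/-! ### Matrix norms and the smallest singular value -/

section Norms

variable {m n : Type*} [Fintype m] [Fintype n]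

/-- The Frobenius norm of a real matrix. -/
def frobNorm (A : Matrix m n ℝ) : ℝ :=
  Matrix.frobeniusNormedAddCommGroup.toNorm.norm A

/-- The spectral norm of a real matrix: its operator norm between Euclidean spaces. -/
def specNorm [DecidableEq n] (A : Matrix m n ℝ) : ℝ :=
  Matrix.instL2OpNormedAddCommGroup.toNorm.norm A

/-- The smallest singular value of a `p × q` matrix, that is, its `min(p, q)`-th largest singular
value. (Mathlib numbers the singular values of a linear map in descending order starting from `0`;
a matrix and its transpose have the same `min(p, q)` leading singular values.) -/
def minSingularValue [DecidableEq m] (A : Matrix m n ℝ) : ℝ :=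
  (Matrix.toEuclideanLin A.transpose).singularValues (min (Fintype.card m) (Fintype.card n) - 1)

end Norms

variable {V : Type*} [Fintype V] [DecidableEq V]

/-- The propagation matrix `D^{-1/2} A D^{-1/2}` of the self-connected graph obtained from the
simple graph `G` by adding a self-loop at every node: `A` is the adjacency matrix of `G` plus the
identity and `D` is its diagonal matrix of row sums, `D i i = G.degree i + 1`. -/
def propMatrix (G : SimpleGraph V) [DecidableRel G.Adj] : Matrix V V ℝ :=
  Matrix.diagonal (fun i => (√((G.degree i : ℝ) + 1))⁻¹) * (G.adjMatrix ℝ + 1) *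
    Matrix.diagonal (fun i => (√((G.degree i : ℝ) + 1))⁻¹)

/-! ### The network

The widths are `d 0, d 1, d 2, …`. The weight matrix called `W^{(ℓ)}` in the usual 1-based
numbering, of size `d (ℓ - 1) × d ℓ`, is the entry number `ℓ - 1` of the parameter family. -/

/-- A family of `n` weight matrices, the entry `ℓ` being of size `d ℓ × d (ℓ + 1)`. -/
abbrev Params (d : ℕ → ℕ) (n : ℕ) : Type :=
  (ℓ : Fin n) → Matrix (Fin (d ℓ)) (Fin (d (ℓ + 1))) ℝ

variable {d : ℕ → ℕ}

/-- All weight matrices but the last. -/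
def Params.init {n : ℕ} (W : Params d (n + 1)) : Params d n := fun ℓ => W ℓ.castSucc

/-- The last weight matrix. -/
def Params.last {n : ℕ} (W : Params d (n + 1)) : Matrix (Fin (d n)) (Fin (d (n + 1))) ℝ :=
  W (Fin.last n)

/-- The hidden representation `H^{(n)}` after `n` graph convolution layers with weights `W`:
`H^{(0)} = X` and `H^{(n+1)} = ReLU (P H^{(n)} W^{(n+1)})`. -/
def hidden (P : Matrix V V ℝ) (X : Matrix V (Fin (d 0)) ℝ) :
    (n : ℕ) → Params d n → Matrix V (Fin (d n)) ℝ
  | 0, _ => X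
  | n + 1, W => (P * hidden P X n W.init * W.last).map (fun x => max x 0)

/-- The input `P H^{(n)} W^{(n+1)}` of the ReLU in layer `n + 1`. -/
def preact (P : Matrix V V ℝ) (X : Matrix V (Fin (d 0)) ℝ) (n : ℕ) (W : Params d (n + 1)) :
    Matrix V (Fin (d (n + 1))) ℝ :=
  P * hidden P X n W.init * W.last

/-- The prediction `H^{(L)} W^{(L+1)}` of the network with `L` hidden layers. -/
def predict (P : Matrix V V ℝ) (X : Matrix V (Fin (d 0)) ℝ) (L : ℕ) (θ : Params d (L + 1)) :
    Matrix V (Fin (d (L + 1))) ℝ :=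
  hidden P X L θ.init * θ.last

/-- The square loss `(1/2) ‖H^{(L)} W^{(L+1)} - Y‖_F ^ 2`. -/
def loss (P : Matrix V V ℝ) (X : Matrix V (Fin (d 0)) ℝ) (L : ℕ)
    (Y : Matrix V (Fin (d (L + 1))) ℝ) (θ : Params d (L + 1)) : ℝ :=
  (1 / 2) * frobNorm (predict P X L θ - Y) ^ 2

/-! ### Gradient descent -/

/-- The derivative of the ReLU, with the usual convention that it is `0` at `0`. -/
def reluDeriv (x : ℝ) : ℝ := if 0 < x then 1 else 0

/-- Reverse-mode chain rule through the `n` graph convolution layers: given the gradient `Δ` of a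
function of `H^{(n)}`, the gradients with respect to all the weight matrices of these layers. -/
def backprop (P : Matrix V V ℝ) (X : Matrix V (Fin (d 0)) ℝ) :
    (n : ℕ) → Params d n → Matrix V (Fin (d n)) ℝ → Params d n
  | 0, _, _ => fun ℓ => ℓ.elim0
  | n + 1, W, Δ =>
    let Z : Matrix V (Fin (d (n + 1))) ℝ :=
      Matrix.of fun v j => reluDeriv (preact P X n W v j) * Δ v j
    Fin.lastCases (motive := fun ℓ => Matrix (Fin (d ℓ)) (Fin (d (ℓ + 1))) ℝ)
      ((P * hidden P X n W.init).transpose * Z)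
      (fun ℓ => backprop P X n W.init (P.transpose * Z * W.last.transpose) ℓ)

/-- The gradient of the loss with respect to all the weight matrices, computed by the chain rule.
It is the true gradient wherever no ReLU is evaluated at its kink, see `hasDerivAt_loss`. -/
def grad (P : Matrix V V ℝ) (X : Matrix V (Fin (d 0)) ℝ) (L : ℕ)
    (Y : Matrix V (Fin (d (L + 1))) ℝ) (θ : Params d (L + 1)) : Params d (L + 1) :=
  let R : Matrix V (Fin (d (L + 1))) ℝ := predict P X L θ - Y
  Fin.lastCases (motive := fun ℓ => Matrix (Fin (d ℓ)) (Fin (d (ℓ + 1))) ℝ)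
    ((hidden P X L θ.init).transpose * R)
    (fun ℓ => backprop P X L θ.init (R * θ.last.transpose) ℓ)

/-- The iterates of full-batch gradient descent with constant learning rate `η` from `θ₀`. -/
def gdIterate (P : Matrix V V ℝ) (X : Matrix V (Fin (d 0)) ℝ) (L : ℕ)
    (Y : Matrix V (Fin (d (L + 1))) ℝ) (η : ℝ) (θ₀ : Params d (L + 1)) : ℕ → Params d (L + 1)
  | 0 => θ₀
  | t + 1 => fun ℓ =>
      gdIterate P X L Y η θ₀ t ℓ - η • grad P X L Y (gdIterate P X L Y η θ₀ t) ℓ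

/-! ### The gradient is the derivative -/

/-- No ReLU is evaluated at `0`. -/
def NoKink (P : Matrix V V ℝ) (X : Matrix V (Fin (d 0)) ℝ) : (n : ℕ) → Params d n → Prop
  | 0, _ => True
  | n + 1, W => NoKink P X n W.init ∧ ∀ v j, preact P X n W v j ≠ 0

lemma frobNorm_sq {m n : Type*} [Fintype m] [Fintype n] (A : Matrix m n ℝ) :
    frobNorm A ^ 2 = ∑ i, ∑ j, A i j ^ 2 := by
  have h : frobNorm A = (∑ i, ∑ j, ‖A i j‖ ^ (2 : ℝ)) ^ (1 / 2 : ℝ) := Matrix.frobenius_norm_def A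
  rw [h, ← Real.sqrt_eq_rpow, Real.sq_sqrt (by positivity)]
  simp

lemma hasDerivAt_relu {x : ℝ} (hx : x ≠ 0) :
    HasDerivAt (fun y : ℝ => max y 0) (reluDeriv x) x := by
  rcases lt_or_gt_of_ne hx with h | h
  · rw [reluDeriv, if_neg h.not_gt]
    refine (hasDerivAt_const x (0 : ℝ)).congr_of_eventuallyEq ?_
    filter_upwards [Iio_mem_nhds h] with y hy using max_eq_right (le_of_lt hy)
  · rw [reluDeriv, if_pos h]
    refine (hasDerivAt_id x).congr_of_eventuallyEq ?_
    filter_upwards [Ioi_mem_nhds h] with y hy using max_eq_left (le_of_lt hy)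

lemma hasDerivAt_mul_entry {l m n : Type*} [Fintype m]
    {A : ℝ → Matrix l m ℝ} {B : ℝ → Matrix m n ℝ} {dA : Matrix l m ℝ} {dB : Matrix m n ℝ} {t : ℝ}
    (hA : ∀ i j, HasDerivAt (fun t => A t i j) (dA i j) t)
    (hB : ∀ i j, HasDerivAt (fun t => B t i j) (dB i j) t) (i : l) (j : n) :
    HasDerivAt (fun t => (A t * B t) i j) ((dA * B t + A t * dB) i j) t := by
  simp only [Matrix.mul_apply, Matrix.add_apply, ← Finset.sum_add_distrib]
  exact HasDerivAt.fun_sum fun k _ => (hA i k).mul (hB k j)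

lemma sum_mul_eq_trace {m n : Type*} [Fintype m] [Fintype n] (A B : Matrix m n ℝ) :
    ∑ i, ∑ j, A i j * B i j = (A.transpose * B).trace := by
  simp only [Matrix.trace, Matrix.diag, Matrix.mul_apply, Matrix.transpose_apply]
  exact Finset.sum_comm

lemma sum_mul_add {k l m n : Type*} [Fintype k] [Fintype l] [Fintype m] [Fintype n]
    (R : Matrix m n ℝ) (P : Matrix m k ℝ) (D : Matrix k l ℝ) (W : Matrix l n ℝ)
    (H : Matrix m l ℝ) (U : Matrix l n ℝ) :
    ∑ i, ∑ j, R i j * (P * D * W + H * U) i j =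
      ∑ i, ∑ j, (P.transpose * R * W.transpose) i j * D i j +
        ∑ i, ∑ j, (H.transpose * R) i j * U i j := by
  rw [sum_mul_eq_trace R, sum_mul_eq_trace _ D, sum_mul_eq_trace _ U, Matrix.mul_add, Matrix.trace_add]
  congr 1
  · simp only [Matrix.transpose_mul, Matrix.transpose_transpose]
    rw [← Matrix.mul_assoc, Matrix.trace_mul_comm _ W]
    simp only [Matrix.mul_assoc]
  · simp only [Matrix.transpose_mul, Matrix.transpose_transpose, Matrix.mul_assoc]

lemma hasDerivAt_hidden (P : Matrix V V ℝ) (X : Matrix V (Fin (d 0)) ℝ) (n : ℕ)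
    (W U : Params d n) (h : NoKink P X n W) :
    ∃ D : Matrix V (Fin (d n)) ℝ,
      (∀ v j, HasDerivAt (fun t : ℝ => hidden P X n (fun ℓ => W ℓ + t • U ℓ) v j) (D v j) 0) ∧
      ∀ Δ : Matrix V (Fin (d n)) ℝ, ∑ v, ∑ j, Δ v j * D v j =
        ∑ ℓ, ∑ i, ∑ j, backprop P X n W Δ ℓ i j * U ℓ i j := by
  induction n with
  | zero => exact ⟨0, fun v j => by simpa [hidden] using hasDerivAt_const _ _, fun Δ => by simp⟩
  | succ n ih =>
    obtain ⟨h1, h2⟩ := h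
    obtain ⟨D, hD, hΔ⟩ := ih W.init U.init h1
    have h0 : (fun ℓ => W ℓ + (0 : ℝ) • U ℓ) = W := by ext; simp
    have h0i : (fun ℓ => W.init ℓ + (0 : ℝ) • U.init ℓ) = W.init := by ext; simp
    have hZ : ∀ v j, HasDerivAt
        (fun t : ℝ => preact P X n (fun ℓ => W ℓ + t • U ℓ) v j)
        ((P * D * W.last + P * hidden P X n W.init * U.last) v j) 0 := by
      intro v j
      have hPH := hasDerivAt_mul_entry (A := fun _ : ℝ => P) (dA := 0) (t := 0)
        (fun i j => by simpa using hasDerivAt_const _ _) hD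
      have hW : ∀ i j, HasDerivAt
          (fun t : ℝ => (W.last + t • U.last) i j) (U.last i j) 0 := by
        intro i j
        simpa using ((hasDerivAt_id (0 : ℝ)).mul_const (U.last i j)).const_add (W.last i j)
      refine (hasDerivAt_mul_entry hPH hW v j).congr_deriv ?_
      rw [h0i]
      simp
    refine ⟨Matrix.of fun v j => reluDeriv (preact P X n W v j) *
      (P * D * W.last + P * hidden P X n W.init * U.last) v j, fun v j => ?_, fun Δ => ?_⟩
    · have hr := hasDerivAt_relu (h2 v j)
      exact HasDerivAt.comp_of_eq (0 : ℝ) hr (hZ v j) (by rw [h0]; rfl)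
    · let Z : Matrix V (Fin (d (n + 1))) ℝ :=
        Matrix.of fun v j => reluDeriv (preact P X n W v j) * Δ v j
      have e1 : ∑ v, ∑ j, Δ v j * (Matrix.of fun v j => reluDeriv (preact P X n W v j) *
          (P * D * W.last + P * hidden P X n W.init * U.last) v j) v j =
          ∑ v, ∑ j, Z v j * (P * D * W.last + P * hidden P X n W.init * U.last) v j := by
        refine Finset.sum_congr rfl fun v _ => Finset.sum_congr rfl fun j _ => ?_
        simp only [Z, Matrix.of_apply]
        ring
      refine e1.trans ((sum_mul_add Z P D W.last (P * hidden P X n W.init) U.last).trans ?_)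
      rw [hΔ, Fin.sum_univ_castSucc]
      simp only [backprop, Fin.lastCases_last, Fin.lastCases_castSucc]
      rfl

/-- Where no ReLU is evaluated at its kink, the derivative of the loss in every direction `U` is
the Euclidean inner product of `grad` with `U`. -/
theorem hasDerivAt_loss (P : Matrix V V ℝ) (X : Matrix V (Fin (d 0)) ℝ) (L : ℕ)
    (Y : Matrix V (Fin (d (L + 1))) ℝ) (θ U : Params d (L + 1)) (h : NoKink P X L θ.init) :
    HasDerivAt (fun t : ℝ => loss P X L Y (fun ℓ => θ ℓ + t • U ℓ))
      (∑ ℓ, ∑ i, ∑ j, grad P X L Y θ ℓ i j * U ℓ i j) 0 := by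
  obtain ⟨D, hD, hΔ⟩ := hasDerivAt_hidden P X L θ.init U.init h
  have h0 : (fun ℓ => θ ℓ + (0 : ℝ) • U ℓ) = θ := by ext; simp
  have h0i : (fun ℓ => θ.init ℓ + (0 : ℝ) • U.init ℓ) = θ.init := by ext; simp
  have hW : ∀ i j, HasDerivAt
      (fun t : ℝ => (θ.last + t • U.last) i j) (U.last i j) 0 := by
    intro i j
    simpa using ((hasDerivAt_id (0 : ℝ)).mul_const (U.last i j)).const_add (θ.last i j)
  have hp : ∀ v j, HasDerivAt (fun t : ℝ => predict P X L (fun ℓ => θ ℓ + t • U ℓ) v j)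
      ((D * θ.last + hidden P X L θ.init * U.last) v j) 0 := by
    intro v j
    refine (hasDerivAt_mul_entry hD hW v j).congr_deriv ?_
    rw [h0i]
    simp
  let R : Matrix V (Fin (d (L + 1))) ℝ := predict P X L θ - Y
  have hl : HasDerivAt (fun t : ℝ => loss P X L Y (fun ℓ => θ ℓ + t • U ℓ))
      (∑ v, ∑ j, R v j * (D * θ.last + hidden P X L θ.init * U.last) v j) 0 := by
    simp only [loss, frobNorm_sq, Matrix.sub_apply, Finset.mul_sum]
    refine HasDerivAt.fun_sum fun v _ => HasDerivAt.fun_sum fun j _ => ?_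
    refine ((((hp v j).sub_const (Y v j)).pow 2).const_mul (1 / 2)).congr_deriv ?_
    simp only [h0, R, Matrix.sub_apply]
    push_cast
    ring
  refine hl.congr_deriv ?_
  have e := sum_mul_add R (1 : Matrix V V ℝ) D θ.last (hidden P X L θ.init) U.last
  rw [Matrix.one_mul, Matrix.transpose_one, Matrix.one_mul, hΔ] at e
  rw [Fin.sum_univ_castSucc]
  simp only [grad, Fin.lastCases_last, Fin.lastCases_castSucc]
  exact e

end

end GCN

namespace GCN

noncomputable section

/-! ### Frobenius and spectral norm inequalities. -/

section NormLemmas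

/-! The output layer alone drives convergence; training the hidden layers is a controlled
perturbation. Write `R` for the residual, `r` for its norm, `H` for the last representation, and
split the change of the prediction in one step as `F = E - η H Hᵀ R`, where `E` comes from the
motion of `H`. If `H` keeps smallest singular value at least `α/2`, then `‖Hᵀ R‖ ≥ (α/2) r`, and the
main term contracts `R`. The third initialization condition makes `E` small; together with the
learning rate bound it also makes `‖F‖ ^ 2` small. Hence `r` shrinks by `q = 1 - η α ^ 2 / 16`
(`frobNorm_predict_sub_step_le`).

These estimates need `‖W^{(ℓ)}‖ ≤ λ_ℓ` at both ends of the step. Gradients are bounded by a constant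
times `r`, so geometric decay of `r` makes the total displacement a convergent geometric series. The
first condition keeps it below `C_ℓ`, the second keeps `H` within `α/2` of its initial value. Decay
and displacement are therefore proved in one induction (`specNorm_sub_and_residual_gdIterate_le`).

Convergence never uses differentiability of the loss: the ReLU enters only as a 1-Lipschitz map
fixing `0`, and its derivative only as a mask bounded by `1`. -/

lemma mul_col_eq_toEuclideanLin {l m n : Type*} [Fintype n] [DecidableEq n]
    (A : Matrix m n ℝ) (B : Matrix n l ℝ) (j : l) :
    WithLp.toLp 2 ((A * B).transpose j) =
      Matrix.toEuclideanLin A (WithLp.toLp 2 (B.transpose j)) := by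
  ext i
  simp [Matrix.mul_apply, Matrix.mulVec, dotProduct]

variable {l m n : Type*} [Fintype l] [Fintype m] [Fintype n]

lemma frobNorm_nonneg (A : Matrix m n ℝ) : 0 ≤ frobNorm A :=
  letI := Matrix.frobeniusNormedAddCommGroup (m := m) (n := n) (α := ℝ)
  norm_nonneg A

lemma frobNorm_zero : frobNorm (0 : Matrix m n ℝ) = 0 :=
  letI := Matrix.frobeniusNormedAddCommGroup (m := m) (n := n) (α := ℝ)
  norm_zero

lemma frobNorm_add_le (A B : Matrix m n ℝ) : frobNorm (A + B) ≤ frobNorm A + frobNorm B :=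
  letI := Matrix.frobeniusNormedAddCommGroup (m := m) (n := n) (α := ℝ)
  norm_add_le A B

lemma frobNorm_neg (A : Matrix m n ℝ) : frobNorm (-A) = frobNorm A :=
  letI := Matrix.frobeniusNormedAddCommGroup (m := m) (n := n) (α := ℝ)
  norm_neg A

lemma frobNorm_smul (c : ℝ) (A : Matrix m n ℝ) : frobNorm (c • A) = |c| * frobNorm A :=
  letI := Matrix.frobeniusNormedAddCommGroup (m := m) (n := n) (α := ℝ)
  letI := Matrix.frobeniusNormedSpace (R := ℝ) (m := m) (n := n) (α := ℝ)
  norm_smul c A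

lemma frobNorm_transpose (A : Matrix m n ℝ) : frobNorm A.transpose = frobNorm A :=
  Matrix.frobenius_norm_transpose A

lemma frobNorm_le_of_abs_le {A B : Matrix m n ℝ} (h : ∀ i j, |A i j| ≤ |B i j|) :
    frobNorm A ≤ frobNorm B := by
  refine le_of_sq_le_sq ?_ (frobNorm_nonneg B)
  rw [frobNorm_sq, frobNorm_sq]
  exact Finset.sum_le_sum fun i _ => Finset.sum_le_sum fun j _ => sq_le_sq.2 (h i j)

lemma frobNorm_sq_eq_sum_col (A : Matrix m n ℝ) :
    frobNorm A ^ 2 = ∑ j, ‖WithLp.toLp 2 (A.transpose j)‖ ^ 2 := by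
  rw [frobNorm_sq, Finset.sum_comm]
  simp [EuclideanSpace.real_norm_sq_eq]

lemma sum_mul_le_frobNorm_mul (A B : Matrix m n ℝ) :
    ∑ i, ∑ j, A i j * B i j ≤ frobNorm A * frobNorm B := by
  refine le_of_sq_le_sq ?_ (mul_nonneg (frobNorm_nonneg A) (frobNorm_nonneg B))
  rw [mul_pow, frobNorm_sq, frobNorm_sq]
  simp only [← Fintype.sum_prod_type' (f := fun i j => A i j * B i j),
    ← Fintype.sum_prod_type' (f := fun i j => A i j ^ 2),
    ← Fintype.sum_prod_type' (f := fun i j => B i j ^ 2)]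
  exact Finset.sum_mul_sq_le_sq_mul_sq _ _ _

lemma frobNorm_add_sq (A B : Matrix m n ℝ) :
    frobNorm (A + B) ^ 2 = frobNorm A ^ 2 + 2 * ∑ i, ∑ j, A i j * B i j + frobNorm B ^ 2 := by
  simp only [frobNorm_sq, Finset.mul_sum, ← Finset.sum_add_distrib, Matrix.add_apply]
  exact Finset.sum_congr rfl fun i _ => Finset.sum_congr rfl fun j _ => by ring

section Spec

variable [DecidableEq n]

lemma specNorm_nonneg (A : Matrix m n ℝ) : 0 ≤ specNorm A :=
  letI := Matrix.instL2OpNormedAddCommGroup (m := m) (n := n) (𝕜 := ℝ)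
  norm_nonneg A

lemma specNorm_add_le (A B : Matrix m n ℝ) : specNorm (A + B) ≤ specNorm A + specNorm B :=
  letI := Matrix.instL2OpNormedAddCommGroup (m := m) (n := n) (𝕜 := ℝ)
  norm_add_le A B

lemma specNorm_transpose [DecidableEq m] (A : Matrix m n ℝ) :
    specNorm A.transpose = specNorm A := by
  rw [← Matrix.conjTranspose_eq_transpose_of_trivial]
  exact Matrix.l2_opNorm_conjTranspose A

lemma norm_toEuclideanLin_le (A : Matrix m n ℝ) (x : EuclideanSpace ℝ n) :
    ‖Matrix.toEuclideanLin A x‖ ≤ specNorm A * ‖x‖ :=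
  Matrix.l2_opNorm_mulVec A x

/-- Squared Frobenius norms add over columns, and `A` acts on each column of `B` separately. -/
lemma frobNorm_mul_le_specNorm_mul (A : Matrix m n ℝ) (B : Matrix n l ℝ) :
    frobNorm (A * B) ≤ specNorm A * frobNorm B := by
  refine le_of_sq_le_sq ?_ (mul_nonneg (specNorm_nonneg A) (frobNorm_nonneg B))
  rw [mul_pow, frobNorm_sq_eq_sum_col, frobNorm_sq_eq_sum_col, Finset.mul_sum]
  refine Finset.sum_le_sum fun j _ => ?_
  rw [mul_col_eq_toEuclideanLin, ← mul_pow]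
  exact pow_le_pow_left₀ (norm_nonneg _) (norm_toEuclideanLin_le A _) 2

lemma frobNorm_mul_le_mul_specNorm (A : Matrix l m ℝ) (B : Matrix m n ℝ) :
    frobNorm (A * B) ≤ frobNorm A * specNorm B := by
  classical
  rw [← frobNorm_transpose, Matrix.transpose_mul, mul_comm, ← specNorm_transpose,
    ← frobNorm_transpose A]
  exact frobNorm_mul_le_specNorm_mul _ _

lemma specNorm_le_frobNorm (A : Matrix m n ℝ) : specNorm A ≤ frobNorm A := by
  refine ContinuousLinearMap.opNorm_le_bound _ (frobNorm_nonneg A) fun x => ?_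
  refine le_of_sq_le_sq ?_ (mul_nonneg (frobNorm_nonneg A) (norm_nonneg x))
  rw [mul_pow, frobNorm_sq, EuclideanSpace.real_norm_sq_eq, EuclideanSpace.real_norm_sq_eq,
    Finset.sum_mul]
  exact Finset.sum_le_sum fun i _ => Finset.sum_mul_sq_le_sq_mul_sq _ _ _

end Spec

lemma frobNorm_mul_le (A : Matrix l m ℝ) (B : Matrix m n ℝ) :
    frobNorm (A * B) ≤ frobNorm A * frobNorm B := by
  classical
  exact (frobNorm_mul_le_mul_specNorm A B).trans
    (mul_le_mul_of_nonneg_left (specNorm_le_frobNorm B) (frobNorm_nonneg A))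

end NormLemmas

/-! ### The smallest singular value -/

/-- In an orthonormal eigenbasis of `T* T`, `‖T x‖ ^ 2` is the sum of the squared coordinates of `x`
weighted by the eigenvalues. With `dim E = k + 1`, index `k` is the smallest of them. -/
lemma singularValues_mul_norm_le {E F : Type*} [NormedAddCommGroup E] [InnerProductSpace ℝ E]
    [FiniteDimensional ℝ E] [NormedAddCommGroup F] [InnerProductSpace ℝ F]
    [FiniteDimensional ℝ F] (T : E →ₗ[ℝ] F) {k : ℕ} (hk : Module.finrank ℝ E = k + 1) (x : E) :
    T.singularValues k * ‖x‖ ≤ ‖T x‖ := by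
  have hT := T.isSymmetric_adjoint_comp_self
  let b := hT.eigenvectorBasis hk
  have key : ‖T x‖ ^ 2 = ∑ i, hT.eigenvalues hk i * (b.repr x i) ^ 2 := by
    rw [← real_inner_self_eq_norm_sq, ← LinearMap.adjoint_inner_right, ← LinearMap.comp_apply,
      ← b.sum_inner_mul_inner]
    refine Finset.sum_congr rfl fun i _ => ?_
    rw [← b.repr_apply_apply, hT.eigenvectorBasis_apply_self_apply, real_inner_comm,
      ← b.repr_apply_apply]
    simp only [RCLike.ofReal_real_eq_id, id_eq]
    ring
  refine le_of_sq_le_sq ?_ (norm_nonneg _)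
  have hx : ‖x‖ ^ 2 = ∑ i, (b.repr x i) ^ 2 := by
    rw [← b.repr.norm_map x, EuclideanSpace.real_norm_sq_eq]
  rw [key, mul_pow, hx, T.sq_singularValues_of_lt hk (Nat.lt_succ_self k), Finset.mul_sum]
  exact Finset.sum_le_sum fun i _ => mul_le_mul_of_nonneg_right
    (hT.eigenvalues_antitone hk (Fin.le_last i)) (sq_nonneg _)

/-- This is where width matters: when `A` has at least as many columns as rows, index `card m - 1`
is the last singular value on the whole domain of `Aᵀ`, so it bounds `Aᵀ` below on each column of
`R`. -/
lemma minSingularValue_mul_frobNorm_le {m n l : Type*} [Fintype m] [Fintype n] [Fintype l]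
    [DecidableEq m] [Nonempty m] (A : Matrix m n ℝ) (h : Fintype.card m ≤ Fintype.card n)
    (R : Matrix m l ℝ) :
    minSingularValue A * frobNorm R ≤ frobNorm (A.transpose * R) := by
  refine le_of_sq_le_sq ?_ (frobNorm_nonneg _)
  rw [mul_pow, frobNorm_sq_eq_sum_col, frobNorm_sq_eq_sum_col, Finset.mul_sum]
  refine Finset.sum_le_sum fun j _ => ?_
  have h0 : 0 ≤ minSingularValue A := LinearMap.singularValues_nonneg _ _
  rw [mul_col_eq_toEuclideanLin, ← mul_pow]
  refine pow_le_pow_left₀ (mul_nonneg h0 (norm_nonneg _)) ?_ 2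
  refine singularValues_mul_norm_le _ ?_ _
  rw [finrank_euclideanSpace, min_eq_left h, Nat.sub_add_cancel Fintype.card_pos]

lemma nonempty_of_minSingularValue_pos {m n : Type*} [Fintype m] [Fintype n] [DecidableEq m]
    (A : Matrix m n ℝ) (h : 0 < minSingularValue A) : Nonempty m := by
  by_contra hm
  rw [not_nonempty_iff] at hm
  refine h.ne' (LinearMap.singularValues_of_finrank_le _ ?_)
  simp

/-! ### The propagation matrix has spectral norm at least one -/

/-- `D^{1/2} 1` is an eigenvector with eigenvalue `1`, because the self-connected adjacency matrix
sends the constant vector `1` to `D 1`. -/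
lemma one_le_specNorm_propMatrix {V : Type*} [Fintype V] [DecidableEq V] [Nonempty V]
    (G : SimpleGraph V) [DecidableRel G.Adj] : 1 ≤ specNorm (propMatrix G) := by
  have hpos : ∀ i, 0 < √((G.degree i : ℝ) + 1) := fun i => by positivity
  let x : EuclideanSpace ℝ V := WithLp.toLp 2 fun i => √((G.degree i : ℝ) + 1)
  have hx : Matrix.toEuclideanLin (propMatrix G) x = x := by
    ext i
    have h1 : (Matrix.diagonal fun i => (√((G.degree i : ℝ) + 1))⁻¹).mulVec
        (fun i => √((G.degree i : ℝ) + 1)) = fun _ => 1 := by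
      ext i
      rw [Matrix.mulVec_diagonal, inv_mul_cancel₀ (hpos i).ne']
    have h2 : (propMatrix G).mulVec (fun i => √((G.degree i : ℝ) + 1)) i =
        √((G.degree i : ℝ) + 1) := by
      rw [propMatrix, ← Matrix.mulVec_mulVec, h1, ← Matrix.mulVec_mulVec, Matrix.mulVec_diagonal,
        Matrix.add_mulVec, Matrix.one_mulVec, Pi.add_apply, SimpleGraph.adjMatrix_mulVec_apply]
      rw [inv_mul_eq_iff_eq_mul₀ (hpos i).ne', Real.mul_self_sqrt (by positivity)]
      simp
    simpa [x] using h2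
  have hx0 : 0 < ‖x‖ := by
    obtain ⟨i⟩ := ‹Nonempty V›
    refine norm_pos_iff.2 fun h => (hpos i).ne' ?_
    simpa [x] using congrArg (fun y : EuclideanSpace ℝ V => y i) h
  have := norm_toEuclideanLin_le (propMatrix G) x
  rw [hx] at this
  exact le_of_mul_le_mul_right (by simpa using this) hx0

variable {V : Type*} [Fintype V] [DecidableEq V] {d : ℕ → ℕ}

/-! ### Bounds on the network and on the back-propagated gradients -/

lemma abs_max_zero_sub_max_zero_le (x y : ℝ) : |max x 0 - max y 0| ≤ |x - y| :=
  abs_max_sub_max_le_abs x y 0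

/-- Each layer multiplies the norm by at most `s * lam ℓ`, and the ReLU does not increase absolute
values. -/
lemma frobNorm_hidden_le (P : Matrix V V ℝ) (X : Matrix V (Fin (d 0)) ℝ) {s : ℝ}
    (hP : specNorm P ≤ s) (n : ℕ) (W : Params d n) (lam : Fin n → ℝ)
    (hW : ∀ ℓ, specNorm (W ℓ) ≤ lam ℓ) :
    frobNorm (hidden P X n W) ≤ s ^ n * frobNorm X * ∏ k, lam k := by
  induction n with
  | zero => simp [hidden]
  | succ n ih =>
    have h := ih W.init (fun ℓ => lam ℓ.castSucc) fun ℓ => hW ℓ.castSucc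
    have hs : 0 ≤ s := (specNorm_nonneg P).trans hP
    have hl := hW (Fin.last n)
    calc frobNorm (hidden P X (n + 1) W)
        ≤ frobNorm (P * hidden P X n W.init * W.last) :=
          frobNorm_le_of_abs_le fun i j => by
            simpa [hidden] using
              abs_max_zero_sub_max_zero_le ((P * hidden P X n W.init * W.last) i j) 0
      _ ≤ frobNorm (P * hidden P X n W.init) * specNorm W.last := frobNorm_mul_le_mul_specNorm _ _
      _ ≤ (specNorm P * frobNorm (hidden P X n W.init)) * specNorm W.last :=
          mul_le_mul_of_nonneg_right (frobNorm_mul_le_specNorm_mul _ _) (specNorm_nonneg _)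
      _ ≤ (s * (s ^ n * frobNorm X * ∏ k : Fin n, lam k.castSucc)) * lam (Fin.last n) :=
          mul_le_mul (mul_le_mul hP h (frobNorm_nonneg _) hs) hl (specNorm_nonneg _)
            (mul_nonneg hs ((frobNorm_nonneg _).trans h))
      _ = s ^ (n + 1) * frobNorm X * ∏ k, lam k := by
          rw [Fin.prod_univ_castSucc]; ring

lemma frobNorm_mul_sub_mul_le {m p : Type*} [Fintype m] [Fintype p] [DecidableEq p] {q : Type*}
    [Fintype q] [DecidableEq q]
    (H H' : Matrix m p ℝ) (W W' : Matrix p q ℝ) {D lam B : ℝ} (hD : frobNorm (H - H') ≤ D)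
    (hW : specNorm W ≤ lam) (hB : frobNorm H' ≤ B) :
    frobNorm (H * W - H' * W') ≤ D * lam + B * specNorm (W - W') := by
  have e : H * W - H' * W' = (H - H') * W + H' * (W - W') := by
    rw [Matrix.sub_mul, Matrix.mul_sub]; abel
  rw [e]
  refine (frobNorm_add_le _ _).trans (add_le_add ?_ ?_)
  · exact (frobNorm_mul_le_mul_specNorm _ _).trans
      (mul_le_mul hD hW (specNorm_nonneg _) ((frobNorm_nonneg _).trans hD))
  · exact (frobNorm_mul_le_mul_specNorm _ _).trans
      (mul_le_mul_of_nonneg_right hB (specNorm_nonneg _))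

/-- The product rule for adding one layer: earlier perturbations are amplified by the new `lam`, and
the new one by the product of the old. -/
lemma sum_prod_div_mul_castSucc {n : ℕ} (lam : Fin (n + 1) → ℝ) (hlam : ∀ ℓ, 0 < lam ℓ)
    (δ : Fin (n + 1) → ℝ) :
    ∑ ℓ, (∏ k, lam k) / lam ℓ * δ ℓ =
      (∑ ℓ : Fin n, (∏ k : Fin n, lam k.castSucc) / lam ℓ.castSucc * δ ℓ.castSucc) *
        lam (Fin.last n) + (∏ k : Fin n, lam k.castSucc) * δ (Fin.last n) := by
  rw [Fin.sum_univ_castSucc, Fin.prod_univ_castSucc, mul_div_cancel_right₀ _ (hlam _).ne',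
    Finset.sum_mul]
  congr 1
  exact Finset.sum_congr rfl fun ℓ _ => by ring

lemma frobNorm_hidden_sub_le (P : Matrix V V ℝ) (X : Matrix V (Fin (d 0)) ℝ) {s : ℝ}
    (hP : specNorm P ≤ s) (n : ℕ) (W W' : Params d n) (lam : Fin n → ℝ) (hlam : ∀ ℓ, 0 < lam ℓ)
    (hW : ∀ ℓ, specNorm (W ℓ) ≤ lam ℓ) (hW' : ∀ ℓ, specNorm (W' ℓ) ≤ lam ℓ) :
    frobNorm (hidden P X n W - hidden P X n W') ≤
      s ^ n * frobNorm X * ∑ ℓ, (∏ k, lam k) / lam ℓ * specNorm (W ℓ - W' ℓ) := by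
  induction n with
  | zero => simp [hidden, frobNorm_zero]
  | succ n ih =>
    have h := ih W.init W'.init (fun ℓ => lam ℓ.castSucc) (fun ℓ => hlam ℓ.castSucc)
      (fun ℓ => hW ℓ.castSucc) fun ℓ => hW' ℓ.castSucc
    have hb := frobNorm_hidden_le P X hP n W'.init (fun ℓ => lam ℓ.castSucc)
      fun ℓ => hW' ℓ.castSucc
    have hs : 0 ≤ s := (specNorm_nonneg P).trans hP
    have hD : frobNorm (P * hidden P X n W.init - P * hidden P X n W'.init) ≤
        s * (s ^ n * frobNorm X * ∑ ℓ : Fin n, (∏ k : Fin n, lam k.castSucc) / lam ℓ.castSucc *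
          specNorm (W ℓ.castSucc - W' ℓ.castSucc)) := by
      rw [← Matrix.mul_sub]
      exact (frobNorm_mul_le_specNorm_mul _ _).trans (mul_le_mul hP h (frobNorm_nonneg _) hs)
    have hB : frobNorm (P * hidden P X n W'.init) ≤
        s * (s ^ n * frobNorm X * ∏ k : Fin n, lam k.castSucc) :=
      (frobNorm_mul_le_specNorm_mul _ _).trans (mul_le_mul hP hb (frobNorm_nonneg _) hs)
    calc frobNorm (hidden P X (n + 1) W - hidden P X (n + 1) W')
        ≤ frobNorm (P * hidden P X n W.init * W.last - P * hidden P X n W'.init * W'.last) :=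
          frobNorm_le_of_abs_le fun i j => abs_max_zero_sub_max_zero_le _ _
      _ ≤ _ := frobNorm_mul_sub_mul_le _ _ _ _ hD (hW (Fin.last n)) hB
      _ = _ := by
          rw [sum_prod_div_mul_castSucc lam hlam fun ℓ => specNorm (W ℓ - W' ℓ)]
          simp only [Params.last]
          ring

lemma frobNorm_predict_sub_le (P : Matrix V V ℝ) (X : Matrix V (Fin (d 0)) ℝ) {s : ℝ}
    (hP : specNorm P ≤ s) (L : ℕ) (θ θ' : Params d (L + 1)) (lam : Fin (L + 1) → ℝ)
    (hlam : ∀ ℓ, 0 < lam ℓ) (hθ : ∀ ℓ, specNorm (θ ℓ) ≤ lam ℓ)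
    (hθ' : ∀ ℓ, specNorm (θ' ℓ) ≤ lam ℓ) :
    frobNorm (predict P X L θ - predict P X L θ') ≤
      s ^ L * frobNorm X * ∑ ℓ, (∏ k, lam k) / lam ℓ * specNorm (θ ℓ - θ' ℓ) := by
  have h := frobNorm_hidden_sub_le P X hP L θ.init θ'.init (fun ℓ => lam ℓ.castSucc)
    (fun ℓ => hlam ℓ.castSucc) (fun ℓ => hθ ℓ.castSucc) fun ℓ => hθ' ℓ.castSucc
  have hb := frobNorm_hidden_le P X hP L θ'.init (fun ℓ => lam ℓ.castSucc)
    fun ℓ => hθ' ℓ.castSucc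
  refine (frobNorm_mul_sub_mul_le _ _ _ _ h (hθ (Fin.last L)) hb).trans_eq ?_
  rw [sum_prod_div_mul_castSucc lam hlam fun ℓ => specNorm (θ ℓ - θ' ℓ)]
  simp only [Params.last, Params.init]
  ring

/-- The ReLU mask has entries `0` or `1`, so it cannot increase the norm. Each layer crossed
backwards costs `s * lam`; on reaching layer `ℓ`, the forward bound supplies the factors before it,
so only `lam ℓ` is missing from the product. -/
lemma frobNorm_backprop_le (P : Matrix V V ℝ) (X : Matrix V (Fin (d 0)) ℝ) {s : ℝ}
    (hP : specNorm P ≤ s) (n : ℕ) (W : Params d n) (lam : Fin n → ℝ) (hlam : ∀ ℓ, 0 < lam ℓ)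
    (hW : ∀ ℓ, specNorm (W ℓ) ≤ lam ℓ) (Δ : Matrix V (Fin (d n)) ℝ) (ℓ : Fin n) :
    frobNorm (backprop P X n W Δ ℓ) ≤
      s ^ n * frobNorm X * ((∏ k, lam k) / lam ℓ) * frobNorm Δ := by
  induction n with
  | zero => exact ℓ.elim0
  | succ n ih =>
    have hs : 0 ≤ s := (specNorm_nonneg P).trans hP
    let Z : Matrix V (Fin (d (n + 1))) ℝ :=
      Matrix.of fun v j => reluDeriv (preact P X n W v j) * Δ v j
    have hZ : frobNorm Z ≤ frobNorm Δ := frobNorm_le_of_abs_le fun v j => by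
      simp only [Z, Matrix.of_apply, abs_mul, reluDeriv]
      split_ifs <;> simp
    rw [Fin.prod_univ_castSucc]
    refine Fin.lastCases ?_ (fun ℓ => ?_) ℓ
    · have hb := frobNorm_hidden_le P X hP n W.init (fun ℓ => lam ℓ.castSucc)
        fun ℓ => hW ℓ.castSucc
      have e : backprop P X (n + 1) W Δ (Fin.last n) = (P * hidden P X n W.init).transpose * Z := by
        simp only [backprop, Fin.lastCases_last, Z]
      rw [e, mul_div_cancel_right₀ _ (hlam _).ne']
      calc _ ≤ frobNorm (P * hidden P X n W.init).transpose * frobNorm Z := frobNorm_mul_le _ _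
        _ ≤ (s * (s ^ n * frobNorm X * ∏ k : Fin n, lam k.castSucc)) * frobNorm Δ := by
            rw [frobNorm_transpose]
            refine mul_le_mul ?_ hZ (frobNorm_nonneg _)
              (mul_nonneg hs ((frobNorm_nonneg _).trans hb))
            exact (frobNorm_mul_le_specNorm_mul _ _).trans (mul_le_mul hP hb (frobNorm_nonneg _) hs)
        _ = _ := by ring
    · have e : backprop P X (n + 1) W Δ ℓ.castSucc =
          backprop P X n W.init (P.transpose * Z * W.last.transpose) ℓ := by
        simp only [backprop, Fin.lastCases_castSucc, Z]
      have hΔ : frobNorm (P.transpose * Z * W.last.transpose) ≤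
          s * frobNorm Δ * lam (Fin.last n) := by
        refine (frobNorm_mul_le_mul_specNorm _ _).trans ?_
        rw [specNorm_transpose]
        refine mul_le_mul ?_ (hW _) (specNorm_nonneg _) (mul_nonneg hs (frobNorm_nonneg _))
        refine (frobNorm_mul_le_specNorm_mul _ _).trans ?_
        rw [specNorm_transpose]
        exact mul_le_mul hP hZ (frobNorm_nonneg _) hs
      have hprod : 0 ≤ (∏ k : Fin n, lam k.castSucc) / lam ℓ.castSucc :=
        div_nonneg (Finset.prod_nonneg fun k _ => (hlam _).le) (hlam _).le
      rw [e]
      refine (ih W.init (fun ℓ => lam ℓ.castSucc) (fun ℓ => hlam _) (fun ℓ => hW _) _ ℓ).trans ?_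
      refine (mul_le_mul_of_nonneg_left hΔ
        (mul_nonneg (mul_nonneg (pow_nonneg hs n) (frobNorm_nonneg X)) hprod)).trans_eq ?_
      ring

lemma frobNorm_grad_le (P : Matrix V V ℝ) (X : Matrix V (Fin (d 0)) ℝ) {s : ℝ}
    (hP : specNorm P ≤ s) (L : ℕ) (Y : Matrix V (Fin (d (L + 1))) ℝ) (θ : Params d (L + 1))
    (lam : Fin (L + 1) → ℝ) (hlam : ∀ ℓ, 0 < lam ℓ) (hθ : ∀ ℓ, specNorm (θ ℓ) ≤ lam ℓ)
    (ℓ : Fin (L + 1)) :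
    frobNorm (grad P X L Y θ ℓ) ≤
      s ^ L * frobNorm X * ((∏ k, lam k) / lam ℓ) * frobNorm (predict P X L θ - Y) := by
  have hs : 0 ≤ s := (specNorm_nonneg P).trans hP
  rw [Fin.prod_univ_castSucc]
  refine Fin.lastCases ?_ (fun ℓ => ?_) ℓ
  · rw [mul_div_cancel_right₀ _ (hlam _).ne']
    simp only [grad, Fin.lastCases_last]
    refine (frobNorm_mul_le _ _).trans ?_
    rw [frobNorm_transpose]
    exact mul_le_mul_of_nonneg_right
      (frobNorm_hidden_le P X hP L θ.init (fun ℓ => lam ℓ.castSucc) fun ℓ => hθ _)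
      (frobNorm_nonneg _)
  · simp only [grad, Fin.lastCases_castSucc]
    have hΔ : frobNorm ((predict P X L θ - Y) * θ.last.transpose) ≤
        frobNorm (predict P X L θ - Y) * lam (Fin.last L) := by
      refine (frobNorm_mul_le_mul_specNorm _ _).trans ?_
      rw [specNorm_transpose]
      exact mul_le_mul_of_nonneg_left (hθ _) (frobNorm_nonneg _)
    have hprod : 0 ≤ (∏ k : Fin L, lam k.castSucc) / lam ℓ.castSucc :=
      div_nonneg (Finset.prod_nonneg fun k _ => (hlam _).le) (hlam _).le
    refine (frobNorm_backprop_le P X hP L θ.init (fun ℓ => lam ℓ.castSucc) (fun ℓ => hlam _)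
      (fun ℓ => hθ _) _ ℓ).trans ?_
    refine (mul_le_mul_of_nonneg_left hΔ
      (mul_nonneg (mul_nonneg (pow_nonneg hs L) (frobNorm_nonneg X)) hprod)).trans_eq ?_
    ring

/-! ### Convergence of gradient descent -/

lemma frobNorm_sub_rev {m n : Type*} [Fintype m] [Fintype n] (A B : Matrix m n ℝ) :
    frobNorm (A - B) = frobNorm (B - A) := by
  rw [← frobNorm_neg, neg_sub]

/-- Both the sensitivity to layer `ℓ` and the size of its gradient scale like `1 / lam ℓ`; hence the
sums of `λ_ℓ^{-2}` in the hypotheses. -/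
lemma sum_div_mul_le {n : ℕ} (lam δ : Fin n → ℝ) (hlam : ∀ ℓ, 0 < lam ℓ) {a c b : ℝ} (ha : 0 ≤ a)
    (hδ : ∀ ℓ, δ ℓ ≤ c * (b / lam ℓ)) :
    ∑ ℓ, a / lam ℓ * δ ℓ ≤ c * a * b * ∑ ℓ, (lam ℓ ^ 2)⁻¹ := by
  rw [Finset.mul_sum]
  refine Finset.sum_le_sum fun ℓ _ => ?_
  refine (mul_le_mul_of_nonneg_left (hδ ℓ) (div_nonneg ha (hlam ℓ).le)).trans_eq ?_
  have := (hlam ℓ).ne'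
  field_simp

lemma frobNorm_predict_sub_step_le (P : Matrix V V ℝ) (X : Matrix V (Fin (d 0)) ℝ) {s : ℝ}
    (hP : specNorm P ≤ s) (L : ℕ) (Y : Matrix V (Fin (d (L + 1))) ℝ) (θ θ' : Params d (L + 1))
    (lam : Fin (L + 1) → ℝ) (hlam : ∀ ℓ, 0 < lam ℓ) (hθ : ∀ ℓ, specNorm (θ ℓ) ≤ lam ℓ)
    (hθ' : ∀ ℓ, specNorm (θ' ℓ) ≤ lam ℓ) {α η : ℝ} (hη_nonneg : 0 ≤ η) (hηα : η * α ^ 2 ≤ 8)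
    (hstep : ∀ ℓ, θ' ℓ = θ ℓ - η • grad P X L Y θ ℓ) (hα : 0 ≤ α)
    (hsv : α / 2 * frobNorm (predict P X L θ - Y) ≤
      frobNorm ((hidden P X L θ.init).transpose * (predict P X L θ - Y)))
    (hwidth : 16 * ((s ^ L * frobNorm X) ^ 2 * (∏ k, lam k) ^ 2 *
      ∑ ℓ : Fin L, (lam ℓ.castSucc ^ 2)⁻¹) ≤ α ^ 2)
    (hrate : η * ((s ^ L * frobNorm X) ^ 2 * (∏ k, lam k) ^ 2 * (∑ ℓ, (lam ℓ ^ 2)⁻¹) ^ 2) ≤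
      ∑ ℓ : Fin L, (lam ℓ.castSucc ^ 2)⁻¹) :
    frobNorm (predict P X L θ' - Y) ≤
      (1 - η * α ^ 2 / 16) * frobNorm (predict P X L θ - Y) := by
  have hs : 0 ≤ s := (specNorm_nonneg P).trans hP
  set R := predict P X L θ - Y with hR
  set r := frobNorm R with hr
  set K := s ^ L * frobNorm X with hK
  set Λ := ∏ k, lam k with hΛ
  set Q := ∑ ℓ, (lam ℓ ^ 2)⁻¹ with hQ
  set S := ∑ ℓ : Fin L, (lam ℓ.castSucc ^ 2)⁻¹ with hS
  have hr0 : 0 ≤ r := frobNorm_nonneg _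
  have hK0 : 0 ≤ K := mul_nonneg (pow_nonneg hs L) (frobNorm_nonneg X)
  have hΛ0 : 0 ≤ Λ := Finset.prod_nonneg fun k _ => (hlam k).le
  have hΛL : 0 ≤ ∏ k : Fin L, lam k.castSucc := Finset.prod_nonneg fun k _ => (hlam _).le
  have hδ : ∀ ℓ, specNorm (θ' ℓ - θ ℓ) ≤ η * K * r * (Λ / lam ℓ) := fun ℓ => by
    refine (specNorm_le_frobNorm _).trans ?_
    rw [hstep ℓ, sub_sub_cancel_left, frobNorm_neg, frobNorm_smul, abs_of_nonneg hη_nonneg]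
    refine (mul_le_mul_of_nonneg_left (frobNorm_grad_le P X hP L Y θ lam hlam hθ ℓ)
      hη_nonneg).trans_eq ?_
    ring
  let F := predict P X L θ' - predict P X L θ
  let E := (hidden P X L θ'.init - hidden P X L θ.init) * θ'.last
  have hF : frobNorm F ≤ η * (K ^ 2 * Λ ^ 2 * Q) * r := by
    refine (frobNorm_predict_sub_le P X hP L θ' θ lam hlam hθ' hθ).trans ?_
    refine (mul_le_mul_of_nonneg_left (sum_div_mul_le lam _ hlam hΛ0 hδ) hK0).trans_eq ?_
    ring
  have hE : frobNorm E ≤ η * (α ^ 2 / 16) * r := by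
    have h1 : frobNorm E ≤ η * (K ^ 2 * Λ ^ 2 * S) * r := by
      refine (frobNorm_mul_le_mul_specNorm _ _).trans ?_
      have h := (frobNorm_hidden_sub_le P X hP L θ'.init θ.init (fun ℓ => lam ℓ.castSucc)
        (fun ℓ => hlam _) (fun ℓ => hθ' _) fun ℓ => hθ _).trans
        (mul_le_mul_of_nonneg_left (sum_div_mul_le (fun ℓ : Fin L => lam ℓ.castSucc) _
          (fun ℓ => hlam _) hΛL fun ℓ => hδ ℓ.castSucc) hK0)
      refine (mul_le_mul h (hθ' _) (specNorm_nonneg _) ((frobNorm_nonneg _).trans h)).trans_eq ?_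
      rw [hΛ, Fin.prod_univ_castSucc]
      ring
    refine h1.trans (mul_le_mul_of_nonneg_right (mul_le_mul_of_nonneg_left ?_ hη_nonneg) hr0)
    linarith
  have hF2 : frobNorm F ^ 2 ≤ η * (α ^ 2 / 16) * r ^ 2 := by
    calc frobNorm F ^ 2 ≤ (η * (K ^ 2 * Λ ^ 2 * Q) * r) ^ 2 :=
          pow_le_pow_left₀ (frobNorm_nonneg _) hF 2
      -- One factor `η` is spent on `hrate`, trading `Q ^ 2` for `S`; what remains is the quantity
      -- bounded by `hwidth`.
      _ = (η * (K ^ 2 * Λ ^ 2 * Q ^ 2)) * (η * (K ^ 2 * Λ ^ 2) * r ^ 2) := by ring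
      _ ≤ S * (η * (K ^ 2 * Λ ^ 2) * r ^ 2) :=
          mul_le_mul_of_nonneg_right hrate (by positivity)
      _ = η * (K ^ 2 * Λ ^ 2 * S) * r ^ 2 := by ring
      _ ≤ _ := by
          refine mul_le_mul_of_nonneg_right (mul_le_mul_of_nonneg_left ?_ hη_nonneg) (sq_nonneg r)
          linarith
  -- Since `E` uses the updated last weight matrix, this identity is exact, with no second-order
  -- remainder.
  have hFE : F = E - η • (hidden P X L θ.init *
      ((hidden P X L θ.init).transpose * R)) := by
    have hl : θ'.last = θ.last - η • ((hidden P X L θ.init).transpose * R) := by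
      have h := hstep (Fin.last L)
      simp only [grad, Fin.lastCases_last] at h
      exact h
    have e : hidden P X L θ.init * θ'.last = hidden P X L θ.init * θ.last -
        η • (hidden P X L θ.init * ((hidden P X L θ.init).transpose * R)) := by
      rw [hl, Matrix.mul_sub, Matrix.mul_smul]
    simp only [F, E, predict, Matrix.sub_mul]
    rw [e]
    abel
  have hG : ∑ i, ∑ j, R i j * (hidden P X L θ.init *
      ((hidden P X L θ.init).transpose * R)) i j =
      frobNorm ((hidden P X L θ.init).transpose * R) ^ 2 := by
    rw [sum_mul_eq_trace, ← Matrix.mul_assoc, frobNorm_sq]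
    simp only [pow_two]
    rw [sum_mul_eq_trace, Matrix.transpose_mul, Matrix.transpose_transpose]
  have hRF : ∑ i, ∑ j, R i j * F i j =
      (∑ i, ∑ j, R i j * E i j) - η * frobNorm ((hidden P X L θ.init).transpose * R) ^ 2 := by
    rw [hFE, ← hG]
    simp only [Matrix.sub_apply, Matrix.smul_apply, smul_eq_mul, mul_sub, Finset.sum_sub_distrib,
      Finset.mul_sum, mul_left_comm η]
  have hRE : ∑ i, ∑ j, R i j * E i j ≤ η * (α ^ 2 / 16) * r ^ 2 := by
    refine (sum_mul_le_frobNorm_mul R E).trans ?_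
    refine (mul_le_mul_of_nonneg_left hE hr0).trans_eq ?_
    ring
  have hsv2 : α ^ 2 / 4 * r ^ 2 ≤ frobNorm ((hidden P X L θ.init).transpose * R) ^ 2 := by
    refine Eq.trans_le ?_ (pow_le_pow_left₀ (by positivity) hsv 2)
    ring
  have hη2 := mul_le_mul_of_nonneg_left hsv2 hη_nonneg
  have hsum : predict P X L θ' - Y = R + F := by simp only [R, F]; abel
  -- With `x = η α ^ 2`, the terms from `E`, `H Hᵀ R` and `‖F‖ ^ 2` give the factor `1 + x/8 - x/2 +
  -- x/16`, which is below `(1 - x/16) ^ 2`; `x ≤ 8` makes `1 - x/16` nonnegative.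
  refine le_of_sq_le_sq ?_ (mul_nonneg (by linarith) hr0)
  rw [hsum, frobNorm_add_sq, hRF]
  have hpos : 0 ≤ η * α ^ 2 * r ^ 2 := by positivity
  have hpos2 : 0 ≤ (η * α ^ 2 / 16) ^ 2 * r ^ 2 := by positivity
  rw [← hr]
  linarith

lemma specNorm_sub_and_residual_gdIterate_le (P : Matrix V V ℝ) (X : Matrix V (Fin (d 0)) ℝ)
    {s : ℝ} (hP : specNorm P ≤ s) (L : ℕ) (Y : Matrix V (Fin (d (L + 1))) ℝ)
    (θ₀ : Params d (L + 1)) (C lam : Fin (L + 1) → ℝ) (hC : ∀ ℓ, 0 < C ℓ)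
    (hlam : ∀ ℓ, lam ℓ = specNorm (θ₀ ℓ) + C ℓ) {α η : ℝ} (hα : 0 < α) (hη_pos : 0 < η)
    (hηα : η * α ^ 2 ≤ 8)
    (hsv : ∀ R : Matrix V (Fin (d (L + 1))) ℝ,
      α * frobNorm R ≤ frobNorm ((hidden P X L θ₀.init).transpose * R))
    (hdist : ∀ ℓ, 16 * (s ^ L * frobNorm X) * ((∏ k, lam k) / lam ℓ) *
      frobNorm (predict P X L θ₀ - Y) ≤ α ^ 2 * C ℓ)
    (hrep : 32 * ((s ^ L * frobNorm X) ^ 2 * (∏ k : Fin L, lam k.castSucc) * (∏ k, lam k) *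
      ∑ ℓ : Fin L, (lam ℓ.castSucc ^ 2)⁻¹) * frobNorm (predict P X L θ₀ - Y) ≤ α ^ 3)
    (hwidth : 16 * ((s ^ L * frobNorm X) ^ 2 * (∏ k, lam k) ^ 2 *
      ∑ ℓ : Fin L, (lam ℓ.castSucc ^ 2)⁻¹) ≤ α ^ 2)
    (hrate : η * ((s ^ L * frobNorm X) ^ 2 * (∏ k, lam k) ^ 2 * (∑ ℓ, (lam ℓ ^ 2)⁻¹) ^ 2) ≤
      ∑ ℓ : Fin L, (lam ℓ.castSucc ^ 2)⁻¹) (t : ℕ) :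
    (∀ ℓ, specNorm (gdIterate P X L Y η θ₀ t ℓ - θ₀ ℓ) ≤
      16 / α ^ 2 * (s ^ L * frobNorm X) * frobNorm (predict P X L θ₀ - Y) *
        (1 - (1 - η * α ^ 2 / 16) ^ t) * ((∏ k, lam k) / lam ℓ)) ∧
    frobNorm (predict P X L (gdIterate P X L Y η θ₀ t) - Y) ≤
      (1 - η * α ^ 2 / 16) ^ t * frobNorm (predict P X L θ₀ - Y) := by
  have hs : 0 ≤ s := (specNorm_nonneg P).trans hP
  have hlam0 : ∀ ℓ, 0 < lam ℓ := fun ℓ => by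
    rw [hlam]; exact add_pos_of_nonneg_of_pos (specNorm_nonneg _) (hC ℓ)
  have hθ₀ : ∀ ℓ, specNorm (θ₀ ℓ) ≤ lam ℓ := fun ℓ => by rw [hlam]; linarith [hC ℓ]
  set r := frobNorm (predict P X L θ₀ - Y) with hr
  set K := s ^ L * frobNorm X with hK
  set q := 1 - η * α ^ 2 / 16 with hq
  set Λ := ∏ k, lam k with hΛ
  have hr0 : 0 ≤ r := frobNorm_nonneg _
  have hK0 : 0 ≤ K := mul_nonneg (pow_nonneg hs L) (frobNorm_nonneg X)
  have hΛ0 : 0 ≤ Λ := Finset.prod_nonneg fun k _ => (hlam0 k).le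
  have hΛL : 0 ≤ ∏ k : Fin L, lam k.castSucc := Finset.prod_nonneg fun k _ => (hlam0 _).le
  have hq0 : 0 ≤ q := by rw [hq]; linarith
  have hα2 : 0 < α ^ 2 := by positivity
  have hball : ∀ (θ : Params d (L + 1)) (t : ℕ),
      (∀ ℓ, specNorm (θ ℓ - θ₀ ℓ) ≤ 16 / α ^ 2 * K * r * (1 - q ^ t) * (Λ / lam ℓ)) →
      (∀ ℓ, specNorm (θ ℓ - θ₀ ℓ) ≤ 16 / α ^ 2 * K * r * (Λ / lam ℓ)) ∧
      ∀ ℓ, specNorm (θ ℓ) ≤ lam ℓ := by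
    intro θ t h
    have h1 : ∀ ℓ, specNorm (θ ℓ - θ₀ ℓ) ≤ 16 / α ^ 2 * K * r * (Λ / lam ℓ) := fun ℓ => by
      refine (h ℓ).trans (mul_le_mul_of_nonneg_right ?_ (div_nonneg hΛ0 (hlam0 ℓ).le))
      exact mul_le_of_le_one_right (by positivity) (by linarith [pow_nonneg hq0 t])
    refine ⟨h1, fun ℓ => ?_⟩
    have h2 : 16 / α ^ 2 * K * r * (Λ / lam ℓ) ≤ C ℓ := by
      rw [show 16 / α ^ 2 * K * r * (Λ / lam ℓ) = 16 * K * (Λ / lam ℓ) * r / α ^ 2 by ring,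
        div_le_iff₀ hα2, mul_comm (C ℓ)]
      exact hdist ℓ
    have h3 := specNorm_add_le (θ ℓ - θ₀ ℓ) (θ₀ ℓ)
    rw [sub_add_cancel] at h3
    rw [hlam ℓ]
    linarith [h1 ℓ]
  induction t with
  | zero =>
    refine ⟨fun ℓ => ?_, by simp [gdIterate, hr]⟩
    refine (specNorm_le_frobNorm _).trans ?_
    simp [gdIterate, frobNorm_zero]
  | succ t ih =>
    obtain ⟨ih1, ih2⟩ := ih
    set θ := gdIterate P X L Y η θ₀ t with hθdef
    obtain ⟨hclose, hθ⟩ := hball θ t ih1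
    have hstep : ∀ ℓ, gdIterate P X L Y η θ₀ (t + 1) ℓ = θ ℓ - η • grad P X L Y θ ℓ :=
      fun ℓ => rfl
    have h1 : ∀ ℓ, specNorm (gdIterate P X L Y η θ₀ (t + 1) ℓ - θ₀ ℓ) ≤
        16 / α ^ 2 * K * r * (1 - q ^ (t + 1)) * (Λ / lam ℓ) := fun ℓ => by
      have hg : specNorm (-(η • grad P X L Y θ ℓ)) ≤ η * (K * (Λ / lam ℓ) * (q ^ t * r)) := by
        refine (specNorm_le_frobNorm _).trans ?_
        rw [frobNorm_neg, frobNorm_smul, abs_of_pos hη_pos]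
        refine mul_le_mul_of_nonneg_left ((frobNorm_grad_le P X hP L Y θ lam hlam0 hθ ℓ).trans ?_)
          hη_pos.le
        exact mul_le_mul_of_nonneg_left ih2
          (mul_nonneg hK0 (div_nonneg hΛ0 (hlam0 ℓ).le))
      have e : gdIterate P X L Y η θ₀ (t + 1) ℓ - θ₀ ℓ =
          (θ ℓ - θ₀ ℓ) + -(η • grad P X L Y θ ℓ) := by rw [hstep]; abel
      rw [e]
      refine (specNorm_add_le _ _).trans ((add_le_add (ih1 ℓ) hg).trans_eq ?_)
      -- With `η` in this form the new increment is proportional to `(1 - q) * q ^ t`, which turns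
      -- `1 - q ^ t` into `1 - q ^ (t + 1)`.
      have e2 : η = 16 / α ^ 2 * (1 - q) := by rw [hq]; field_simp; ring
      rw [show η * (K * (Λ / lam ℓ) * (q ^ t * r)) =
        16 / α ^ 2 * (1 - q) * (K * (Λ / lam ℓ) * (q ^ t * r)) from congrArg (· * _) e2]
      ring
    refine ⟨h1, ?_⟩
    obtain ⟨-, hθ'⟩ := hball _ (t + 1) h1
    have hH : frobNorm (hidden P X L θ₀.init - hidden P X L θ.init) ≤ α / 2 := by
      rw [frobNorm_sub_rev]
      refine (frobNorm_hidden_sub_le P X hP L θ.init θ₀.init (fun ℓ => lam ℓ.castSucc)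
        (fun ℓ => hlam0 _) (fun ℓ => hθ _) fun ℓ => hθ₀ _).trans ?_
      refine (mul_le_mul_of_nonneg_left (sum_div_mul_le (fun ℓ : Fin L => lam ℓ.castSucc) _
          (fun ℓ => hlam0 _) hΛL fun ℓ => hclose ℓ.castSucc) hK0).trans ?_
      -- Scaled by `2 α ^ 2`, the displacement bound becomes exactly `hrep`.
      refine le_of_mul_le_mul_left ?_ (by positivity : 0 < 2 * α ^ 2)
      refine Eq.trans_le ?_ (hrep.trans_eq ?_)
      · field_simp
        ring
      · ring
    have hsvt : α / 2 * frobNorm (predict P X L θ - Y) ≤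
        frobNorm ((hidden P X L θ.init).transpose * (predict P X L θ - Y)) := by
      -- `H₀ᵀ R = Hᵀ R + (H₀ - H)ᵀ R`: of the initial lower bound `α ‖R‖`, at most half is lost.
      have h := frobNorm_add_le ((hidden P X L θ.init).transpose * (predict P X L θ - Y))
        ((hidden P X L θ₀.init - hidden P X L θ.init).transpose * (predict P X L θ - Y))
      rw [← Matrix.add_mul, ← Matrix.transpose_add, add_sub_cancel] at h
      have h2 := frobNorm_mul_le (hidden P X L θ₀.init - hidden P X L θ.init).transpose
        (predict P X L θ - Y)
      rw [frobNorm_transpose] at h2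
      have h3 := mul_le_mul_of_nonneg_right hH (frobNorm_nonneg (predict P X L θ - Y))
      linarith [hsv (predict P X L θ - Y)]
    refine (frobNorm_predict_sub_step_le P X hP L Y θ _ lam hlam0 hθ hθ' hη_pos.le hηα hstep hα.le
      hsvt hwidth hrate).trans ?_
    rw [pow_succ' q, mul_assoc]
    exact mul_le_mul_of_nonneg_left ih2 hq0

end

end GCN

theorem theorem2 {V : Type*} [Fintype V] [DecidableEq V]
    -- the graph, the depth and the widths
    (G : SimpleGraph V) [DecidableRel G.Adj] (L : ℕ) (d : ℕ → ℕ)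
    -- features and targets
    (X : Matrix V (Fin (d 0)) ℝ) (Y : Matrix V (Fin (d (L + 1))) ℝ)
    -- the last hidden layer is wide
    (hwidth : Fintype.card V ≤ d L)
    -- initial weights, and the quantities attached to them
    (θ₀ : GCN.Params d (L + 1))
    (s : ℝ) (hs : GCN.specNorm (GCN.propMatrix G) ≤ s)
    (C : Fin (L + 1) → ℝ) (hC : ∀ ℓ, 0 < C ℓ)
    (lam : Fin (L + 1) → ℝ) (hlam : ∀ ℓ, lam ℓ = GCN.specNorm (θ₀ ℓ) + C ℓ)
    (α₀ : ℝ) (hα₀ : α₀ = GCN.minSingularValue (GCN.hidden (GCN.propMatrix G) X L θ₀.init))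
    (hα₀_pos : 0 < α₀)
    (loss₀ : ℝ) (hloss₀ : loss₀ = GCN.loss (GCN.propMatrix G) X L Y θ₀)
    -- the three initialization conditions
    (hinit₁ : 16 * s ^ (2 * L) * GCN.frobNorm X *
      (⨆ ℓ : Fin (L + 1), (∏ k, lam k) / (lam ℓ * C ℓ)) * √(2 * loss₀) ≤ α₀ ^ 2)
    (hinit₂ : 32 * s ^ (2 * L) * GCN.frobNorm X ^ 2 * lam (Fin.last L) *
      (∑ ℓ : Fin L, (∏ k : Fin L, lam k.castSucc) ^ 2 / lam ℓ.castSucc ^ 2) *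
        √(2 * loss₀) ≤ α₀ ^ 3)
    (hinit₃ : 16 * s ^ (2 * L) * GCN.frobNorm X ^ 2 * lam (Fin.last L) ^ 2 *
      (∑ ℓ : Fin L, (∏ k : Fin L, lam k.castSucc) ^ 2 / lam ℓ.castSucc ^ 2) ≤ α₀ ^ 2)
    -- the learning rate
    (η : ℝ) (hη_pos : 0 < η)
    (hη : η ≤ min (8 / α₀ ^ 2)
      ((∑ ℓ : Fin L, (lam ℓ.castSucc ^ 2)⁻¹) /
        (s ^ (2 * L) * (∏ k, lam k) ^ 2 * GCN.frobNorm X ^ 2 *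
          (∑ ℓ, (lam ℓ ^ 2)⁻¹) ^ 2)))
    -- the target error and the number of iterations
    (ε : ℝ) (hε : 0 < ε) (T : ℕ)
    (hT : 8 / (η * α₀ ^ 2) * Real.log (loss₀ / ε) ≤ (T : ℝ)) :
    GCN.loss (GCN.propMatrix G) X L Y
      (GCN.gdIterate (GCN.propMatrix G) X L Y η θ₀ T) ≤ ε := by
  set P := GCN.propMatrix G
  set R₀ := GCN.predict P X L θ₀ - Y
  have : Nonempty V := GCN.nonempty_of_minSingularValue_pos _ (hα₀ ▸ hα₀_pos)
  have hs1 : 1 ≤ s := (GCN.one_le_specNorm_propMatrix G).trans hs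
  have hlam0 : ∀ ℓ, 0 < lam ℓ := fun ℓ => by
    rw [hlam]; exact add_pos_of_nonneg_of_pos (GCN.specNorm_nonneg _) (hC ℓ)
  have hX := GCN.frobNorm_nonneg X
  have hr0 : 0 ≤ GCN.frobNorm R₀ := GCN.frobNorm_nonneg _
  have hloss : 2 * loss₀ = GCN.frobNorm R₀ ^ 2 := by
    rw [hloss₀, GCN.loss]; ring
  rw [hloss, Real.sqrt_sq hr0] at hinit₁ hinit₂
  have hΛ0 : 0 < ∏ k, lam k := Finset.prod_pos fun k _ => hlam0 k
  have hS : ∑ ℓ : Fin L, (∏ k : Fin L, lam k.castSucc) ^ 2 / lam ℓ.castSucc ^ 2 =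
      (∏ k : Fin L, lam k.castSucc) ^ 2 * ∑ ℓ : Fin L, (lam ℓ.castSucc ^ 2)⁻¹ := by
    rw [Finset.mul_sum]
    exact Finset.sum_congr rfl fun ℓ _ => div_eq_mul_inv _ _
  have hprod : ∏ k, lam k = (∏ k : Fin L, lam k.castSucc) * lam (Fin.last L) :=
    Fin.prod_univ_castSucc lam
  have hηα : η * α₀ ^ 2 ≤ 8 := (le_div_iff₀ (by positivity)).1 (hη.trans (min_le_left _ _))
  have hdist : ∀ ℓ, 16 * (s ^ L * GCN.frobNorm X) * ((∏ k, lam k) / lam ℓ) *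
      GCN.frobNorm R₀ ≤ α₀ ^ 2 * C ℓ := fun ℓ => by
    have hsup : (∏ k, lam k) / (lam ℓ * C ℓ) ≤ ⨆ ℓ, (∏ k, lam k) / (lam ℓ * C ℓ) :=
      le_ciSup (f := fun ℓ => (∏ k, lam k) / (lam ℓ * C ℓ)) (Set.finite_range _).bddAbove ℓ
    -- The displacement bound needs only `s ^ L`; passing to the assumed `s ^ (2 * L)` requires `1 ≤
    -- s`.
    have hpow : s ^ L ≤ s ^ (2 * L) := pow_le_pow_right₀ hs1 (by lia)
    have hs0 : 0 ≤ s := zero_le_one.trans hs1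
    have hdiv : 0 ≤ (∏ k, lam k) / (lam ℓ * C ℓ) :=
      div_nonneg hΛ0.le (mul_nonneg (hlam0 ℓ).le (hC ℓ).le)
    have h : 16 * s ^ L * GCN.frobNorm X * ((∏ k, lam k) / (lam ℓ * C ℓ)) * GCN.frobNorm R₀ ≤
        α₀ ^ 2 := by
      refine le_trans ?_ hinit₁
      gcongr
    refine Eq.trans_le ?_ (mul_le_mul_of_nonneg_right h (hC ℓ).le)
    have := (hC ℓ).ne'
    have := (hlam0 ℓ).ne'
    field_simp
  have hrate : η * ((s ^ L * GCN.frobNorm X) ^ 2 * (∏ k, lam k) ^ 2 *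
      (∑ ℓ, (lam ℓ ^ 2)⁻¹) ^ 2) ≤ ∑ ℓ : Fin L, (lam ℓ.castSucc ^ 2)⁻¹ := by
    have h := hη.trans (min_le_right _ _)
    have hne : 0 ≤ s ^ (2 * L) * (∏ k, lam k) ^ 2 * GCN.frobNorm X ^ 2 *
        (∑ ℓ, (lam ℓ ^ 2)⁻¹) ^ 2 := by
      have hs0 : 0 ≤ s := zero_le_one.trans hs1
      positivity
    -- If the denominator vanishes, division by zero gives `0`, and the rate bound would contradict
    -- `0 < η`.
    rcases hne.eq_or_lt with h0 | h0
    · rw [← h0, div_zero] at h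
      exact absurd h hη_pos.not_ge
    · refine Eq.trans_le ?_ ((le_div_iff₀ h0).1 h)
      ring
  obtain ⟨-, hT'⟩ := GCN.specNorm_sub_and_residual_gdIterate_le P X hs L Y θ₀ C lam hC hlam hα₀_pos
    hη_pos hηα
    (fun R => hα₀ ▸ GCN.minSingularValue_mul_frobNorm_le _ (by simpa using hwidth) R) hdist
    (Eq.trans_le (by rw [hS, hprod]; ring) hinit₂) (Eq.trans_le (by rw [hS, hprod]; ring) hinit₃)
    hrate T
  have hq0 : 0 ≤ 1 - η * α₀ ^ 2 / 16 := by linarith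
  -- The loss is quadratic in the residual, so the rate `1/16` doubles to `1/8`.
  have hbound : GCN.loss P X L Y (GCN.gdIterate P X L Y η θ₀ T) ≤
      Real.exp (-(η * α₀ ^ 2 / 8 * T)) * loss₀ := by
    have hexp : (1 - η * α₀ ^ 2 / 16) ^ T ≤ Real.exp (-(η * α₀ ^ 2 / 16 * T)) := by
      refine (pow_le_pow_left₀ hq0 (Real.one_sub_le_exp_neg _) T).trans_eq ?_
      rw [← Real.exp_nat_mul]
      ring_nf
    have h := hT'.trans (mul_le_mul_of_nonneg_right hexp hr0)
    have h2 := pow_le_pow_left₀ (GCN.frobNorm_nonneg _) h 2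
    rw [mul_pow, ← Real.exp_nat_mul, ← hloss] at h2
    rw [GCN.loss]
    refine (mul_le_mul_of_nonneg_left h2 (by norm_num)).trans_eq ?_
    push_cast
    ring_nf
  refine hbound.trans ?_
  have hloss0 : 0 ≤ loss₀ := by linarith [sq_nonneg (GCN.frobNorm R₀)]
  -- Zero initial loss is separate: `Real.log 0 = 0` makes `hT` carry no information, but `hbound`
  -- already gives zero loss.
  rcases hloss0.eq_or_lt with h0 | h0
  · rw [← h0, mul_zero]
    exact hε.le
  have hlog : Real.log (loss₀ / ε) ≤ η * α₀ ^ 2 / 8 * T := by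
    have hc : 0 < η * α₀ ^ 2 / 8 := by positivity
    refine Eq.trans_le ?_ (mul_le_mul_of_nonneg_left hT hc.le)
    field_simp
  have hle : loss₀ / ε ≤ Real.exp (η * α₀ ^ 2 / 8 * T) :=
    (Real.log_le_iff_le_exp (div_pos h0 hε)).1 hlog
  rw [Real.exp_neg, inv_mul_le_iff₀ (Real.exp_pos _)]
  exact (div_le_iff₀ hε).1 hle
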